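/- Let $n>2$ and let $A$ be an $\mathbb S_n$-stable subgroup of $(C_2)^n$, where $C_2=\{1,g_2\}$, $\chi_2$ is the nontrivial character of $C_2$, and $\mathbb S_n$ acts by permuting the coordinates. Put $G=A\rtimes\mathbb S_n$. (For $A=1$, $A=(C_2)^n$, and $A$ the subgroup of elements with an even number of entries $g_2$, this is the Weyl group of type $A_{n-1}$, of types $B_n,C_n$, and of type $D_n$.) Let ${\rm RSR}(G,r,\overrightarrow\rho,u)$ be a ramification system with irreducible representations over $\mathbb C$: a cardinal number $r_C$ and an element $u(C)\in C$ for every conjugacy class $C$ of $G$, and a family $(\rho_C^{(i)})_{i\in I_C(r,u)}$ of irreducible representations of the centralizer $G^{u(C)}$ of $u(C)$ in $G$ whose direct sum has dimension $r_C$. Assume that $r\neq 0$. The system is said to be of central quantum linear type, and its Nichols algebra $\mathfrak B(G,r,\overrightarrow\rho,u)$ is then called a central quantum linear space over $G$, if (a) it is quantum symmetric: the Yetter-Drinfeld module $\bigoplus_{C}\bigoplus_{i\in I_C(r,u)}M(\mathcal O_{u(C)},\rho_C^{(i)})$ has a basis $(x_b)$ in which its braiding is $c(x_b\otimes x_{b'})=q_{b,b'}\,x_{b'}\otimes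 x_b$ with scalars satisfying $q_{b,b'}q_{b',b}=1$ for all $b\ne b'$; here $M(\mathcal O_s,\rho)=\mathbb CG\otimes_{\mathbb CG^s}V$ for a representation $\rho$ of $G^s$ on $V$, with $G$ acting on the left factor and coaction $\delta(g\otimes v)=gsg^{-1}\otimes(g\otimes v)$; (b) it is of the non-essentially infinite type: whenever $r_C\neq0$ and $i\in I_C(r,u)$, the element $u(C)$ acts in $\rho_C^{(i)}$ as a scalar that is a root of unity different from $1$; (c) $C\subseteq Z(G)$ whenever $r_C\ne 0$. Then $\mathfrak B(G,r,\overrightarrow\rho,u)$ is a central quantum linear space over $G$ if and only if the following hold: $(g_2,\dots,g_2)\in A$; the set $C=\{(g_2,\dots,g_2)\}$ is a conjugacy class of $G$ and $r=r_CC$, i.e. $r_{C'}=0$ for every class $C'\neq C$; and for every $i\in I_C(r,u)$ there are $\delta_1,\dots,\delta_n\in\{0,1\}$ with $\delta_1+\cdots+\delta_n$ odd and an irreducible representation $\mu$ of $(\mathbb S_n)_\chi=\{h\in\mathbb S_n: h\cdot\chi=\chi\}$, where $\chi=(\chi_2^{\delta_1}\otimes\cdots\otimes\chi_2^{\delta_n})|_A$,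 such that $$\rho_C^{(i)}\cong\theta_{\chi,\mu}:=(\chi\otimes\mu)\uparrow_{G_\chi^{u(C)}}^{G^{u(C)}}$$ and $\theta_{\chi,\mu}$ is irreducible. Here $G_\chi=A\rtimes(\mathbb S_n)_\chi$, $G_\chi^{u(C)}$ is the centralizer of $u(C)$ in $G_\chi$, and $\chi\otimes\mu$ is the representation $(a,h)\mapsto\chi(a)\mu(h)$. -/

import Mathlib

open scoped TensorProduct DirectSum

universe u v

noncomputable section

/-! ### Yetter-Drinfeld modules and ramification systems with irreducible representations -/

section YetterDrinfeld

variable {G : Type u} [Group G]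

/-- The representation of `G` underlying the Yetter-Drinfeld module `M(O_s, ρ) = ℂG ⊗_{ℂG^s} V`,
where `G^s` is the centralizer of `s` and `ρ` is a representation of `G^s` on `V`.
In Mathlib's model of the induced representation, the element `g ⊗ v` of `M(O_s, ρ)` is
`Representation.IndV.mk _ ρ g⁻¹ v`. -/
def ydAction (s : G) {V : Type v} [AddCommGroup V] [Module ℂ V]
    (ρ : Representation ℂ (Subgroup.centralizer {s}) V) :
    Representation ℂ G (Representation.IndV (Subgroup.centralizer {s}).subtype ρ) :=
  Representation.ind (Subgroup.centralizer {s}).subtype ρ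

open Classical in
/-- The projection of `M(O_s, ρ)` onto its homogeneous component of degree `t : G`.
The coaction is `δ (g ⊗ v) = g s g⁻¹ ⊗ (g ⊗ v)`, i.e. `g ⊗ v` is homogeneous of degree `g s g⁻¹`;
recall that `IndV.mk _ ρ h v` is `h⁻¹ ⊗ v`, which has degree `h⁻¹ s h`. -/
def ydProj (s : G) {V : Type v} [AddCommGroup V] [Module ℂ V]
    (ρ : Representation ℂ (Subgroup.centralizer {s}) V) (t : G) :
    Representation.IndV (Subgroup.centralizer {s}).subtype ρ →ₗ[ℂ]
      Representation.IndV (Subgroup.centralizer {s}).subtype ρ :=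
  Representation.Coinvariants.lift _
    (TensorProduct.lift <|
      (Finsupp.lift _ _ _ fun h : G =>
        if h⁻¹ * s * h = t then
          Representation.IndV.mk (Subgroup.centralizer {s}).subtype ρ h else 0) ∘ₗ
      (MonoidAlgebra.coeffLinearEquiv ℂ).toLinearMap)
    (by
      rintro ⟨x, hx⟩
      ext h a
      have hx' : s * x = x * s := Subgroup.mem_centralizer_singleton_iff.1 hx |>.symm
      have key : (x * h)⁻¹ * s * (x * h) = h⁻¹ * s * h := by
        have : x⁻¹ * s * x = s := by rw [mul_assoc, hx', inv_mul_cancel_left]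
        calc (x * h)⁻¹ * s * (x * h) = h⁻¹ * (x⁻¹ * s * x) * h := by group
          _ = _ := by rw [this]
      have := Representation.Coinvariants.mk_self_apply
        (Representation.tprod ((Representation.leftRegular ℂ G).comp
          (Subgroup.centralizer {s}).subtype) ρ) ⟨x, hx⟩ (MonoidAlgebra.single h 1 ⊗ₜ[ℂ] a)
      by_cases ht : h⁻¹ * s * h = t
      · simp_all
      · simp_all)

/-- `ydProj` acts on the generators as described: the element `h⁻¹ ⊗ v` is homogeneous of degree
`h⁻¹ s h`. -/
theorem ydProj_mk [DecidableEq G] (s : G) {V : Type v} [AddCommGroup V] [Module ℂ V]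
    (ρ : Representation ℂ (Subgroup.centralizer {s}) V) (t h : G) (a : V) :
    ydProj s ρ t (Representation.IndV.mk (Subgroup.centralizer {s}).subtype ρ h a) =
      if h⁻¹ * s * h = t then
        Representation.IndV.mk (Subgroup.centralizer {s}).subtype ρ h a else 0 := by
  by_cases ht : h⁻¹ * s * h = t <;> simp [ydProj, ht]

end YetterDrinfeld

/-- A ramification system with irreducible representations `RSR(G, r, ρ, u)` over `ℂ`:
a ramification `r` (a cardinal number `r C` for every conjugacy class `C`), a choice `u C ∈ C`, and
for every `C` a family `(ρ C i)`, `i ∈ I C`, of irreducible representations of the centralizer of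
`u C` whose direct sum has dimension `r C`. (If `r C = 0` this says precisely that `I C` is empty,
so that the representations are data for the classes with `r C ≠ 0` only.) -/
structure RSR (G : Type u) [Group G] where
  /-- the ramification -/
  r : ConjClasses G → Cardinal.{v}
  /-- the chosen representative of each conjugacy class -/
  u : ConjClasses G → G
  u_mem : ∀ C, u C ∈ C.carrier
  /-- the index set of the irreducible constituents belonging to a class -/
  I : ConjClasses G → Type v
  /-- the spaces of the irreducible constituents -/
  V : ∀ C, I C → Type v
  [addCommGroup : ∀ C i, AddCommGroup (V C i)]
  [module : ∀ C i, Module ℂ (V C i)]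
  /-- the irreducible constituents -/
  ρ : ∀ C i, Representation ℂ (Subgroup.centralizer {u C}) (V C i)
  irreducible : ∀ C i, (ρ C i).IsIrreducible
  rank_eq : ∀ C, Module.rank ℂ (⨁ i, V C i) = r C

namespace RSR

attribute [instance] RSR.addCommGroup RSR.module

variable {G : Type u} [Group G] (R : RSR.{u, v} G)

/-- The underlying space of the Yetter-Drinfeld module of an RSR,
`⨁_{C} ⨁_{i ∈ I C} M(O_{u C}, ρ C i)`. -/
abbrev YD : Type (max u v) :=
  ⨁ p : (Σ C, R.I C),
    Representation.IndV (Subgroup.centralizer {R.u p.1}).subtype (R.ρ p.1 p.2)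

/-- The action of `g : G` on the Yetter-Drinfeld module of an RSR. -/
def act (g : G) : R.YD →ₗ[ℂ] R.YD :=
  DirectSum.lmap fun p => ydAction (R.u p.1) (R.ρ p.1 p.2) g

/-- The projection of the Yetter-Drinfeld module of an RSR onto the component of degree `g : G`. -/
def proj (g : G) : R.YD →ₗ[ℂ] R.YD :=
  DirectSum.lmap fun p => ydProj (R.u p.1) (R.ρ p.1 p.2) g

/-- The Yetter-Drinfeld braiding `c (x ⊗ y) = x₍₋₁₎ • y ⊗ x₍₀₎ = ∑ₜ t • y ⊗ xₜ`, where `xₜ` is the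
component of `x` of degree `t`. -/
def braiding [Finite G] : R.YD ⊗[ℂ] R.YD →ₗ[ℂ] R.YD ⊗[ℂ] R.YD :=
  letI := Fintype.ofFinite G
  (∑ t : G, TensorProduct.map (R.act t) (R.proj t)) ∘ₗ
    (TensorProduct.comm ℂ R.YD R.YD).toLinearMap

/-- `RSR` is quantum symmetric: its braided vector space is of diagonal type,
`c (x_a ⊗ x_b) = q_{ab} x_b ⊗ x_a` in some basis, with `q_{ab} q_{ba} = 1` for `a ≠ b`. -/
def IsQuantumSymmetric [Finite G] : Prop :=
  ∃ (ι : Type (max u v)) (x : Module.Basis ι ℂ R.YD) (q : ι → ι → ℂ),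
    (∀ a b, R.braiding (x a ⊗ₜ[ℂ] x b) = q a b • (x b ⊗ₜ[ℂ] x a)) ∧
      ∀ a b, a ≠ b → q a b * q b a = 1

/-- `RSR` is of the non-essentially infinite type: for every class `C` in the support of `r` and
every `i`, the central element `u C` of the centralizer acts in `ρ C i` as a root of unity
different from `1`. -/
def IsNonEssentiallyInfinite : Prop :=
  ∀ C, R.r C ≠ 0 → ∀ i : R.I C, ∃ q : ℂ,
    R.ρ C i ⟨R.u C, Subgroup.mem_centralizer_singleton_iff.2 rfl⟩ = q • LinearMap.id ∧
      q ≠ 1 ∧ IsOfFinOrder q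

/-- `RSR` is of central quantum linear type, in other words its Nichols algebra is a
central quantum linear space. -/
structure IsCentralQuantumLinear [Finite G] : Prop where
  quantumSymmetric : R.IsQuantumSymmetric
  nonEssentiallyInfinite : R.IsNonEssentiallyInfinite
  central : ∀ C, R.r C ≠ 0 → C.carrier ⊆ (Subgroup.center G : Set G)

end RSR

/-! ### Induced representations of a semidirect product -/

section Semidirect

variable {A D : Type*} [Group A] [Group D] {φ : D →* MulAut A}

/-- The stabilizer `D_χ` of a character `χ` of `A`, where `(h • χ) a = χ (h⁻¹ • a)`. -/
def charStabilizer (φ : D →* MulAut A) (χ : A →* ℂˣ) : Subgroup D where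
  carrier := {h | ∀ a, χ (φ h⁻¹ a) = χ a}
  one_mem' a := by rw [inv_one, map_one, MulAut.one_apply]
  mul_mem' {g h} hg hh a := by
    change ∀ a, χ (φ g⁻¹ a) = χ a at hg
    change ∀ a, χ (φ h⁻¹ a) = χ a at hh
    rw [mul_inv_rev, map_mul, MulAut.mul_apply, hh, hg]
  inv_mem' {g} hg a := by
    change ∀ a, χ (φ g⁻¹ a) = χ a at hg
    rw [← hg (φ g⁻¹⁻¹ a), ← MulAut.mul_apply, ← map_mul]
    simp

/-- The subgroup `G_χ = A ⋊ D_χ` of `G = A ⋊ D`. -/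
abbrev semidirectStabilizer (φ : D →* MulAut A) (χ : A →* ℂˣ) : Subgroup (A ⋊[φ] D) :=
  (charStabilizer φ χ).comap SemidirectProduct.rightHom

/-- The representation `χ ⊗ μ` of `G_χ = A ⋊ D_χ`, `(a, h) ↦ χ a • μ h`. -/
def charTensor (χ : A →* ℂˣ) {W : Type*} [AddCommGroup W] [Module ℂ W]
    (μ : Representation ℂ (charStabilizer φ χ) W) :
    Representation ℂ (semidirectStabilizer φ χ) W where
  toFun g := (χ g.1.left : ℂ) •
    μ ((SemidirectProduct.rightHom (φ := φ)).subgroupComap (charStabilizer φ χ) g)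
  map_one' := by
    rw [map_one, map_one]
    simp
  map_mul' g h := by
    have h1 : χ (φ g.1.right h.1.left) = χ h.1.left := by
      have := (charStabilizer φ χ).inv_mem g.2 h.1.left
      simpa using this
    rw [map_mul, map_mul]
    simp [h1, smul_smul, mul_comm]

/-- The representation `θ_{χ, μ} = (χ ⊗ μ) ↑` of the centralizer `G^s` of `s` that is induced from
the restriction of `χ ⊗ μ` to the centralizer `G_χ^s` of `s` in `G_χ`. -/
def theta (s : A ⋊[φ] D) (χ : A →* ℂˣ) {W : Type*} [AddCommGroup W] [Module ℂ W]
    (μ : Representation ℂ (charStabilizer φ χ) W) :=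
  Representation.ind
    (Subgroup.inclusion (inf_le_right :
      semidirectStabilizer φ χ ⊓ Subgroup.centralizer {s} ≤ Subgroup.centralizer {s}))
    ((charTensor χ μ).comp (Subgroup.inclusion (inf_le_left :
      semidirectStabilizer φ χ ⊓ Subgroup.centralizer {s} ≤ semidirectStabilizer φ χ)))

end Semidirect

/-! ### Classical Weyl groups -/

/-- The cyclic group of order two, written multiplicatively. -/
abbrev C2 : Type := Multiplicative (ZMod 2)

/-- The generator of `C2`. -/
def g2 : C2 := Multiplicative.ofAdd 1

/-- The character of order two of `C2`. -/
def chi2 : C2 →* ℂˣ where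
  toFun x := if x = 1 then 1 else -1
  map_one' := by simp
  map_mul' x y := by
    have hx : x = 1 ∨ x = g2 := by revert x; decide
    have hy : y = 1 ∨ y = g2 := by revert y; decide
    have h1 : g2 ≠ 1 := by decide
    have h2 : g2 * g2 = 1 := by decide
    rcases hx with rfl | rfl <;> rcases hy with rfl | rfl <;> simp [h1, h2]

/-- A subgroup `A` of `(C_2)^n` that is stable under the permutation action
`(h • a) i = a (h⁻¹ i)` of the symmetric group. -/
structure SignGroup (n : ℕ) extends Subgroup (Fin n → C2) where
  perm_mem : ∀ (h : Equiv.Perm (Fin n)) (a : Fin n → C2),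
    a ∈ toSubgroup → (fun i => a (h⁻¹ i)) ∈ toSubgroup

namespace SignGroup

variable {n : ℕ} (A : SignGroup n)

/-- The action of the symmetric group on `A`. -/
def permAction : Equiv.Perm (Fin n) →* MulAut A.toSubgroup where
  toFun h :=
    { toFun := fun a => ⟨fun i => a.1 (h⁻¹ i), A.perm_mem h a.1 a.2⟩
      invFun := fun a => ⟨fun i => a.1 (h i), by simpa using A.perm_mem h⁻¹ a.1 a.2⟩
      left_inv := fun a => by ext i; simp
      right_inv := fun a => by ext i; simp
      map_mul' := fun a b => rfl }
  map_one' := rfl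
  map_mul' g h := by ext a i; simp [MulAut.mul_apply]

/-- The group `A ⋊ S_n`. The Weyl groups of types `A_{n-1}`, `B_n` and `C_n`, `D_n` are obtained
for `A` trivial, `A = (C_2)^n`, and `A` the subgroup of elements with an even number of entries
`g2`, respectively. -/
abbrev Weyl : Type := A.toSubgroup ⋊[A.permAction] Equiv.Perm (Fin n)

instance : Finite A.Weyl := Finite.of_equiv _ SemidirectProduct.equivProd.symm

/-- The restriction to `A` of the character `χ_2^{δ_1} ⊗ ⋯ ⊗ χ_2^{δ_n}` of `(C_2)^n`. -/
def signChar (δ : Fin n → Fin 2) : A.toSubgroup →* ℂˣ where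
  toFun a := ∏ j, chi2 (a.1 j) ^ (δ j : ℕ)
  map_one' := by simp
  map_mul' a b := by simp [mul_pow, Finset.prod_mul_distrib]

end SignGroup

end

/-!
For `n > 2` the symmetric group has trivial center, so a central element of `G = A ⋊ S_n` is a
constant sign vector: it is `1` or `z = (g2, …, g2)`. If the system is of central quantum linear
type, then `u C` is central for every `C` in the support of `r`, and `u C ≠ 1` because `1` acts
trivially; hence the support is `{z}`, and the centralizer of `u C = z` is all of `G`. An irreducible
representation `ρ` of it contains a character `χ` of the finite commutative group `A`, and Clifford
theory (`weightRep_isIrreducible_and_equiv_theta`) identifies `ρ` with `θ_{χ, μ}`, where `μ` is the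
`χ`-weight space as a representation of the stabilizer of `χ`. Every character of `A` extends to
`C2 ^ n`, so `χ` has the form `signChar δ`; finally `z` acts as `χ z = (-1) ^ ∑ δ_j`, and this is
different from `1` exactly when `∑ δ_j` is odd.

Conversely, if the support is `{z}` and all constituents are such `θ_{χ, μ}`, then `z` acts as `-1`
on the whole Yetter-Drinfeld module, which is homogeneous of degree `z`. So the braiding is the
negative of the flip, which is diagonal in any basis with all `q_{ab} = -1`.

The Clifford theory rests on the projections `weightProj` onto the weight spaces of `A` and on
`Representation.nonempty_equiv_ind`: the map from the induced representation given by Frobenius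
reciprocity has a left inverse, obtained by averaging the projection over the group, so that no
coset representatives are needed.
-/

namespace Representation

/-! ### Irreducible representations -/

section Irreducible

variable {k G V W : Type*} [Field k] [Monoid G] [AddCommGroup V] [Module k V]
  [AddCommGroup W] [Module k W] {ρ : Representation k G V} {σ : Representation k G W}

theorem isIrreducible_iff : ρ.IsIrreducible ↔ Nontrivial V ∧
    ∀ N : Submodule k V, (∀ g, ∀ v ∈ N, ρ g v ∈ N) → N = ⊥ ∨ N = ⊤ := by
  constructor
  · intro h
    refine ⟨?_, fun N hN => ?_⟩
    · by_contra hV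
      rw [not_nontrivial_iff_subsingleton] at hV
      refine bot_ne_top (α := Subrepresentation ρ) (Subrepresentation.toSubmodule_injective ?_)
      exact Subsingleton.elim _ _
    · rcases h.eq_bot_or_eq_top ⟨N, fun g v hv => hN g v hv⟩ with h | h
      · exact Or.inl (congrArg Subrepresentation.toSubmodule h)
      · exact Or.inr (congrArg Subrepresentation.toSubmodule h)
  · rintro ⟨hV, h⟩
    refine { exists_pair_ne := ⟨⊥, ⊤, fun e => ?_⟩, eq_bot_or_eq_top := fun N => ?_ }
    · exact bot_ne_top (α := Submodule k V) (congrArg Subrepresentation.toSubmodule e)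
    · rcases h N.toSubmodule fun g v hv => N.apply_mem_toSubmodule g hv with h | h
      · exact Or.inl (Subrepresentation.toSubmodule_injective h)
      · exact Or.inr (Subrepresentation.toSubmodule_injective h)

theorem IsIrreducible.nontrivial (h : ρ.IsIrreducible) : Nontrivial V :=
  (isIrreducible_iff.1 h).1

theorem IsIrreducible.of_equiv (h : ρ.IsIrreducible) (e : ρ.Equiv σ) : σ.IsIrreducible := by
  rw [isIrreducible_iff] at h ⊢
  have := h.1
  refine ⟨e.symm.toLinearEquiv.toEquiv.nontrivial, fun N hN => ?_⟩
  have hinj : Function.Injective (Submodule.comap e.toLinearEquiv.toLinearMap) :=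
    Submodule.comap_injective_of_surjective e.toLinearEquiv.surjective
  have hstab : ∀ g, ∀ v ∈ N.comap e.toLinearEquiv.toLinearMap,
      ρ g v ∈ N.comap e.toLinearEquiv.toLinearMap := fun g v hv => by
    rw [Submodule.mem_comap, show e.toLinearEquiv.toLinearMap (ρ g v) =
      σ g (e.toLinearEquiv.toLinearMap v) from
        IntertwiningMap.isIntertwining ρ σ e.toIntertwiningMap g v]
    exact hN g _ hv
  rcases h.2 _ hstab with h | h
  · exact Or.inl (hinj (by rw [h, Submodule.comap_bot]; exact e.toLinearEquiv.ker.symm))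
  · exact Or.inr (hinj h)

theorem Equiv.apply_eq_smul_id (e : ρ.Equiv σ) {g : G} {c : k} (h : σ g = c • LinearMap.id) :
    ρ g = c • LinearMap.id := by
  refine LinearMap.ext fun v => e.toLinearEquiv.injective ?_
  refine (IntertwiningMap.isIntertwining ρ σ e.toIntertwiningMap g v).trans ?_
  rw [h]
  exact (map_smul e.toLinearEquiv c v).symm

end Irreducible

/-! ### Recognizing induced representations -/

section Induced

variable {k H K V W : Type*} [Field k] [Group H] [Group K]
  [AddCommGroup V] [Module k V] [AddCommGroup W] [Module k W]

theorem IndV.mk_map_mul (φ : H →* K) (σ : Representation k H W) (x : H) (g : K) (w : W) :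
    IndV.mk φ σ (φ x * g) (σ x w) = IndV.mk φ σ g w := by
  have := Coinvariants.mk_self_apply (Representation.tprod ((leftRegular k K).comp φ) σ) x
    (MonoidAlgebra.single g 1 ⊗ₜ[k] w)
  simpa using this

/-- A criterion for an irreducible representation `τ` of `K` on `V` to be induced from a
representation `σ` of a subgroup `H`: the space `W` of `σ` is an `H`-equivariant direct summand of
`V`, and the projection onto it kills the translates of `W` by elements outside of `H`. -/
theorem nonempty_equiv_ind [CharZero k] [Finite K] {φ : H →* K} (hφ : Function.Injective φ)
    (σ : Representation k H W)
    {τ : Representation k K V} (hτ : τ.IsIrreducible) [Nontrivial W] (j : W →ₗ[k] V)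
    (p : V →ₗ[k] W) (hj : ∀ h w, τ (φ h) (j w) = j (σ h w)) (hp : ∀ w, p (j w) = w)
    (hp0 : ∀ g, g ∉ Set.range φ → ∀ w, p (τ g (j w)) = 0) : Nonempty (τ.Equiv (ind φ σ)) := by
  classical
  have : Finite H := Finite.of_injective φ hφ
  let _ := Fintype.ofFinite K
  let _ := Fintype.ofFinite H
  -- the map given by Frobenius reciprocity
  let f : IndV φ σ →ₗ[k] V := Coinvariants.lift _
    (TensorProduct.lift <| (Finsupp.lift _ _ _ fun g : K => τ g⁻¹ ∘ₗ j) ∘ₗ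
      (MonoidAlgebra.coeffLinearEquiv k).toLinearMap) (by
    intro x
    ext g w
    simp [← hj, ← Module.End.mul_apply, ← map_mul])
  have hf : ∀ g w, f (IndV.mk φ σ g w) = τ g⁻¹ (j w) := fun g w => by simp [f]
  -- a left inverse, obtained by averaging over `K`
  let s : V →ₗ[k] IndV φ σ :=
    (Fintype.card H : k)⁻¹ • ∑ g : K, IndV.mk φ σ g ∘ₗ p ∘ₗ τ g
  have hs : s ∘ₗ f = LinearMap.id := by
    refine IndV.hom_ext _ _ fun h => LinearMap.ext fun w => ?_
    have h1 : ∑ g : K, IndV.mk φ σ g (p (τ g (τ h⁻¹ (j w)))) =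
        ∑ g : K, IndV.mk φ σ (g * h) (p (τ g (j w))) := by
      refine (Fintype.sum_equiv (Equiv.mulRight h) _ _ fun g => ?_).symm
      rw [Equiv.coe_mulRight, ← Module.End.mul_apply (τ (g * h)), ← map_mul, mul_inv_cancel_right]
    have h2 : ∑ x : H, IndV.mk φ σ h w = ∑ g : K, IndV.mk φ σ (g * h) (p (τ g (j w))) := by
      refine Fintype.sum_of_injective φ hφ _ _ (fun g hg => ?_) fun x => ?_
      · rw [hp0 g hg, map_zero]
      · rw [hj, hp, IndV.mk_map_mul]
    change s (f (IndV.mk φ σ h w)) = IndV.mk φ σ h w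
    have hsv : ∀ v, s v = (Fintype.card H : k)⁻¹ • ∑ g : K, IndV.mk φ σ g (p (τ g v)) := fun v =>
      (LinearMap.smul_apply _ _ _).trans (congrArg _ (LinearMap.sum_apply _ _ _))
    rw [hf, hsv, h1, ← h2, Finset.sum_const, Finset.card_univ, ← Nat.cast_smul_eq_nsmul k, smul_smul,
      inv_mul_cancel₀ (by simp), one_smul]
  have hinj : Function.Injective f := fun x y h => by
    rw [← LinearMap.id_apply (R := k) x, ← LinearMap.id_apply (R := k) y, ← hs,
      LinearMap.comp_apply, h, LinearMap.comp_apply]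
  have hfe : ∀ g x, f (ind φ σ g x) = τ g (f x) := fun g x => by
    refine LinearMap.congr_fun (f := f ∘ₗ ind φ σ g) (g := τ g ∘ₗ f)
      (IndV.hom_ext _ _ fun h => LinearMap.ext fun w => ?_) x
    change f (ind φ σ g (IndV.mk φ σ h w)) = τ g (f (IndV.mk φ σ h w))
    rw [ind_mk, hf, hf, mul_inv_rev, inv_inv, map_mul, Module.End.mul_apply]
  have hsurj : LinearMap.range f = ⊤ := by
    refine ((isIrreducible_iff.1 hτ).2 (LinearMap.range f) ?_).resolve_left fun h0 => ?_
    · rintro g _ ⟨x, rfl⟩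
      exact ⟨_, hfe g x⟩
    · obtain ⟨w, hw⟩ := exists_ne (0 : W)
      apply hw
      rw [← hp w]
      have : f (IndV.mk φ σ 1 w) = 0 := by
        rw [← Submodule.mem_bot k, ← h0]
        exact ⟨_, rfl⟩
      rw [hf, inv_one, map_one, Module.End.one_apply] at this
      rw [this, map_zero]
  exact ⟨(Equiv.mk (LinearEquiv.ofBijective f ⟨hinj, LinearMap.range_eq_top.1 hsurj⟩)
    fun g => LinearMap.ext fun x => hfe g x).symm⟩

end Induced

/-! ### Weight spaces of finite commutative groups -/

section Weight

variable {A V : Type*} [CommGroup A] [AddCommGroup V] [Module ℂ V]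

/-- The weight space of a character `χ` in a representation of `A`. -/
def weightSpace (τ : Representation ℂ A V) (χ : A →* ℂˣ) : Submodule ℂ V where
  carrier := {v | ∀ a, τ a v = (χ a : ℂ) • v}
  add_mem' hv hw a := by rw [map_add, hv a, hw a, smul_add]
  zero_mem' a := by rw [map_zero, smul_zero]
  smul_mem' c v hv a := by rw [map_smul, hv a, smul_comm]

variable [Fintype A]

/-- The projection `|A|⁻¹ ∑ₐ χ(a)⁻¹ a` onto the weight space of `χ`. -/
noncomputable def weightProj (τ : Representation ℂ A V) (χ : A →* ℂˣ) : V →ₗ[ℂ] V :=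
  (Fintype.card A : ℂ)⁻¹ • ∑ a, (χ a⁻¹ : ℂ) • τ a

theorem weightProj_apply (τ : Representation ℂ A V) (χ : A →* ℂˣ) (v : V) :
    weightProj τ χ v = (Fintype.card A : ℂ)⁻¹ • ∑ a, (χ a⁻¹ : ℂ) • τ a v := by
  simp [weightProj, LinearMap.sum_apply]

theorem weightProj_mem (τ : Representation ℂ A V) (χ : A →* ℂˣ) (v : V) :
    weightProj τ χ v ∈ weightSpace τ χ := by
  intro b
  rw [weightProj_apply, map_smul (τ b), smul_comm, map_sum]
  congr 1
  rw [Finset.smul_sum]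
  refine Fintype.sum_equiv (Equiv.mulLeft b) _ _ fun a => ?_
  rw [map_smul (τ b), Equiv.coe_mulLeft, map_mul, Module.End.mul_apply, smul_smul, mul_inv_rev,
    map_mul, Units.val_mul, mul_left_comm, ← Units.val_mul (χ b), ← map_mul, mul_inv_cancel, map_one,
    Units.val_one, mul_one]

theorem weightProj_of_mem {τ : Representation ℂ A V} {χ : A →* ℂˣ} {v : V}
    (hv : v ∈ weightSpace τ χ) : weightProj τ χ v = v := by
  have h : ∀ a, (χ a⁻¹ : ℂ) • τ a v = v := fun a => by
    rw [hv a, smul_smul, ← Units.val_mul, ← map_mul, inv_mul_cancel, map_one, Units.val_one,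
      one_smul]
  rw [weightProj_apply, Finset.sum_congr rfl fun a _ => h a, Finset.sum_const, Finset.card_univ,
    ← Nat.cast_smul_eq_nsmul ℂ, smul_smul, inv_mul_cancel₀ (by simp), one_smul]

theorem weightProj_of_mem_of_ne {τ : Representation ℂ A V} {χ ψ : A →* ℂˣ} (hne : ψ ≠ χ) {v : V}
    (hv : v ∈ weightSpace τ ψ) : weightProj τ χ v = 0 := by
  have h0 : ∑ a, ((Units.coeHom ℂ).comp (χ⁻¹ * ψ)) a = 0 := by
    refine sum_hom_units_eq_zero ((Units.coeHom ℂ).comp (χ⁻¹ * ψ)) fun h => hne ?_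
    refine MonoidHom.ext fun a => ?_
    have := DFunLike.congr_fun h a
    simp only [MonoidHom.comp_apply, Units.coeHom_apply, MonoidHom.one_apply, Units.val_eq_one,
      MonoidHom.mul_apply, MonoidHom.inv_apply] at this
    exact (inv_mul_eq_one.1 this).symm
  have h : ∀ a, (χ a⁻¹ : ℂ) • τ a v = ((Units.coeHom ℂ).comp (χ⁻¹ * ψ)) a • v := fun a => by
    rw [hv a, smul_smul, map_inv]
    rfl
  rw [weightProj_apply, Finset.sum_congr rfl fun a _ => h a, ← Finset.sum_smul, h0, zero_smul,
    smul_zero]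

/-- A nonzero representation of a finite commutative group contains a character, because the
projections onto the weight spaces add up to the identity. -/
theorem exists_weightSpace_ne_bot [Nontrivial V] (τ : Representation ℂ A V) :
    ∃ χ, weightSpace τ χ ≠ ⊥ := by
  classical
  by_contra! h
  obtain ⟨v, hv⟩ := exists_ne (0 : V)
  let _ := Fintype.ofFinite (A →* ℂˣ)
  have h0 : ∀ χ : A →* ℂˣ, ∑ a, (χ a⁻¹ : ℂ) • τ a v = 0 := fun χ => by
    have := weightProj_mem τ χ v
    rw [h χ, Submodule.mem_bot, weightProj_apply] at this
    exact (smul_eq_zero.1 this).resolve_left (by simp)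
  have h1 : ∀ a : A, a ≠ 1 → ∑ χ : A →* ℂˣ, (χ a⁻¹ : ℂ) = 0 := fun a ha => by
    refine sum_hom_units_eq_zero ((Units.coeHom ℂ).comp (MonoidHom.eval a⁻¹)) fun h => ?_
    obtain ⟨χ, hχ⟩ := CommGroup.exists_apply_ne_one_of_hasEnoughRootsOfUnity A ℂ (inv_ne_one.2 ha)
    exact hχ (Units.val_eq_one.1 (DFunLike.congr_fun h χ))
  have h2 : ∑ χ : A →* ℂˣ, ∑ a, (χ a⁻¹ : ℂ) • τ a v = 0 := Finset.sum_eq_zero fun χ _ => h0 χ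
  rw [Finset.sum_comm, Finset.sum_eq_single 1] at h2
  · simp only [inv_one, map_one, Units.val_one, one_smul, Module.End.one_apply, Finset.sum_const,
      Finset.card_univ, ← Nat.cast_smul_eq_nsmul ℂ] at h2
    exact (smul_eq_zero.1 h2).elim (by simp) hv
  · intro a _ ha
    rw [← Finset.sum_smul, h1 a ha, zero_smul]
  · simp

end Weight

end Representation

/-! ### Clifford theory for semidirect products -/

section Clifford

open Representation

variable {A D : Type*} [CommGroup A] [Group D] {φ : D →* MulAut A}

theorem inl_mul_inr_mul_inl (a b : A) (d : D) :
    (SemidirectProduct.inl a * (SemidirectProduct.inl b * SemidirectProduct.inr d) : A ⋊[φ] D) =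
      (SemidirectProduct.inl b * SemidirectProduct.inr d) * SemidirectProduct.inl (φ d⁻¹ a) := by
  rw [map_inv, SemidirectProduct.inl_aut_inv]
  simp only [← mul_assoc]
  rw [← map_mul, mul_comm a b, map_mul]
  simp [mul_assoc]

/-- A central element `a ∈ A` of `A ⋊ D` acts in `θ_{χ, μ}` as the scalar `χ a`. -/
theorem theta_apply_of_mem_center {s : A ⋊[φ] D} {a : A} (hs : s = SemidirectProduct.inl a)
    (hc : s ∈ Subgroup.center (A ⋊[φ] D)) (χ : A →* ℂˣ) {W : Type*} [AddCommGroup W] [Module ℂ W]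
    (μ : Representation ℂ (charStabilizer φ χ) W) (h : s ∈ Subgroup.centralizer {s})
    {c : ℂ} (hχ : (χ a : ℂ) = c) : theta s χ μ ⟨s, h⟩ = c • LinearMap.id := by
  subst hχ
  refine IndV.hom_ext _ _ fun g => LinearMap.ext fun w => ?_
  have hmem : s ∈ semidirectStabilizer φ χ ⊓ Subgroup.centralizer {s} := by
    refine ⟨?_, h⟩
    change SemidirectProduct.rightHom s ∈ charStabilizer φ χ
    rw [hs, SemidirectProduct.rightHom_inl]
    exact one_mem _
  have hg : g * (⟨s, h⟩ : Subgroup.centralizer {s})⁻¹ =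
      (Subgroup.inclusion inf_le_right ⟨s, hmem⟩)⁻¹ * g :=
    Subtype.ext (Subgroup.mem_center_iff.1 (inv_mem hc) g.1)
  have hμ : charTensor χ μ (Subgroup.inclusion inf_le_left ⟨s, hmem⟩) w = (χ a : ℂ) • w := by
    have h1 : (SemidirectProduct.rightHom (φ := φ)).subgroupComap (charStabilizer φ χ)
        (Subgroup.inclusion inf_le_left ⟨s, hmem⟩) = 1 :=
      Subtype.ext (by subst hs; exact SemidirectProduct.rightHom_inl a)
    change (χ s.left : ℂ) • μ _ w = _
    rw [h1, map_one, hs, SemidirectProduct.left_inl, Module.End.one_apply]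
  rw [LinearMap.comp_apply, LinearMap.comp_apply (g := IndV.mk _ _ g), LinearMap.smul_apply,
    LinearMap.id_apply, ← map_smul]
  refine (ind_mk _ _ _ _ _).trans ?_
  rw [hg, ← IndV.mk_map_mul _ _ ⟨s, hmem⟩, mul_inv_cancel_left]
  exact congrArg _ hμ

variable {s : A ⋊[φ] D} {V : Type v} [AddCommGroup V] [Module ℂ V]

/-- An element of `G`, seen in the centralizer of a central element. -/
def toCentralizer (hs : s ∈ Subgroup.center (A ⋊[φ] D)) :
    A ⋊[φ] D →* Subgroup.centralizer {s} :=
  (MonoidHom.id _).codRestrict _ fun g =>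
    Subgroup.mem_centralizer_singleton_iff.2 (Subgroup.mem_center_iff.1 hs g)

/-- An element `a d` of `A ⋊ D` maps the weight space of `χ` to that of `d • χ`. -/
theorem apply_mem_weightSpace (ρ : Representation ℂ (A ⋊[φ] D) V) {χ : A →* ℂˣ} {v : V}
    (hv : v ∈ weightSpace (ρ.comp SemidirectProduct.inl) χ) (g : A ⋊[φ] D) :
    ρ g v ∈ weightSpace (ρ.comp SemidirectProduct.inl)
      (χ.comp (φ g.right⁻¹).toMonoidHom) := by
  intro a
  change ρ (SemidirectProduct.inl a) (ρ g v) = (χ (φ g.right⁻¹ a) : ℂ) • ρ g v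
  rw [← Module.End.mul_apply, ← map_mul]
  nth_rewrite 1 [← SemidirectProduct.inl_left_mul_inr_right g]
  rw [inl_mul_inr_mul_inl, SemidirectProduct.inl_left_mul_inr_right, map_mul,
    Module.End.mul_apply, ← map_smul]
  exact congrArg _ (hv _)

/-- The weight space of `χ` as a representation of the stabilizer of `χ`. -/
def weightRep (ρ : Representation ℂ (A ⋊[φ] D) V) (χ : A →* ℂˣ) :
    Representation ℂ (charStabilizer φ χ)
      (weightSpace (ρ.comp SemidirectProduct.inl) χ) where
  toFun h := (ρ (SemidirectProduct.inr h.1)).restrict fun v hv => by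
    have := apply_mem_weightSpace ρ hv (SemidirectProduct.inr h.1)
    rwa [show χ.comp (φ (SemidirectProduct.inr h.1 : A ⋊[φ] D).right⁻¹).toMonoidHom = χ from
      MonoidHom.ext h.2] at this
  map_one' := by ext; simp
  map_mul' g h := by ext; simp

/-- Clifford theory: an irreducible representation of `G^s = A ⋊ D`, for `s` central, is induced
from the weight space `μ` of any character `χ` of `A` that occurs in it. The averaging projection
onto the weight space turns each translate of a subrepresentation of `μ` into `0` or back into that
subrepresentation, whence `μ` is irreducible. -/
theorem weightRep_isIrreducible_and_equiv_theta [Finite A] [Finite D]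
    (hs : s ∈ Subgroup.center (A ⋊[φ] D))
    {ρ : Representation ℂ (Subgroup.centralizer {s}) V} (hρ : ρ.IsIrreducible) {χ : A →* ℂˣ}
    (hχ : weightSpace ((ρ.comp (toCentralizer hs)).comp SemidirectProduct.inl) χ ≠ ⊥) :
    (weightRep (ρ.comp (toCentralizer hs)) χ).IsIrreducible ∧
      Nonempty (ρ.Equiv (theta s χ (weightRep (ρ.comp (toCentralizer hs)) χ))) := by
  have := Fintype.ofFinite A
  have : Finite (A ⋊[φ] D) := Finite.of_equiv _ SemidirectProduct.equivProd.symm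
  set ρ' : Representation ℂ (A ⋊[φ] D) V := ρ.comp (toCentralizer hs)
  set X := weightSpace (ρ'.comp SemidirectProduct.inl) χ
  let p : V →ₗ[ℂ] X := (weightProj (ρ'.comp SemidirectProduct.inl) χ).codRestrict X
    (weightProj_mem _ χ)
  have hp : ∀ w : X, p w = w := fun w => Subtype.ext (weightProj_of_mem w.2)
  have hp0 : ∀ g, g.right ∉ charStabilizer φ χ → ∀ w : X, p (ρ' g w) = 0 := fun g hg w =>
    Subtype.ext (weightProj_of_mem_of_ne (fun h => hg fun a => DFunLike.congr_fun h a)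
      (apply_mem_weightSpace ρ' w.2 g))
  have hpin : ∀ g (hg : g.right ∈ charStabilizer φ χ) (w : X),
      ρ' g w = (χ g.left : ℂ) • weightRep ρ' χ ⟨g.right, hg⟩ w := fun g hg w => by
    nth_rewrite 1 [← SemidirectProduct.inl_left_mul_inr_right g]
    rw [map_mul]
    exact (weightRep ρ' χ ⟨g.right, hg⟩ w).2 g.left
  have : Nontrivial X := Submodule.nontrivial_iff_ne_bot.2 hχ
  refine ⟨isIrreducible_iff.2 ⟨this, fun N hN => ?_⟩, ?_⟩
  · rw [or_iff_not_imp_left]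
    intro hN0
    obtain ⟨w, hw, hw0⟩ := N.exists_mem_ne_zero_of_ne_bot hN0
    -- the vectors all of whose translates are projected into `N`
    let M : Submodule ℂ V := ⨅ g, N.comap (p ∘ₗ ρ g)
    have hM : ∀ v, v ∈ M ↔ ∀ g, p (ρ g v) ∈ N := fun v => by simp [M]
    have hwM : (w : V) ∈ M := (hM _).2 fun g => by
      by_cases hg : g.1.right ∈ charStabilizer φ χ
      · have h : ρ g w = _ := hpin g.1 hg w
        rw [h, map_smul, hp]
        exact N.smul_mem _ (hN _ _ hw)
      · have h : p (ρ g w) = 0 := hp0 g.1 hg w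
        rw [h]
        exact N.zero_mem
    have htop : M = ⊤ := by
      refine ((isIrreducible_iff.1 hρ).2 M fun g v hv => (hM _).2 fun h => ?_).resolve_left
        fun h => hw0 ?_
      · rw [← Module.End.mul_apply, ← map_mul]
        exact (hM v).1 hv _
      · rw [h, Submodule.mem_bot] at hwM
        exact Subtype.ext hwM
    refine eq_top_iff.2 fun x _ => ?_
    have := (hM x).1 (htop ▸ Submodule.mem_top) 1
    rwa [map_one, Module.End.one_apply, hp] at this
  · refine nonempty_equiv_ind (Subgroup.inclusion_injective _) _ hρ X.subtype p (fun h w => ?_) hp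
      fun g hg w => ?_
    · exact hpin h.1 h.2.1 w
    · refine hp0 g.1 (fun h => hg ⟨⟨g.1, h, g.2⟩, rfl⟩) w

end Clifford

/-! ### Ramification systems supported at a central element -/

namespace RSR

open Representation

variable {G : Type u} [Group G] (R : RSR.{u, v} G)

/-- The support of `r` consists of the classes that carry a representation, as irreducible
representations are nonzero. -/
theorem nonempty_I_iff (C : ConjClasses G) : Nonempty (R.I C) ↔ R.r C ≠ 0 := by
  rw [← R.rank_eq C, Ne, rank_zero_iff, not_subsingleton_iff_nontrivial]
  constructor
  · rintro ⟨i⟩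
    classical
    have := (R.irreducible C i).nontrivial
    exact (DirectSum.of_injective (β := R.V C) i).nontrivial
  · intro h
    by_contra hI
    rw [not_nonempty_iff] at hI
    exact not_subsingleton (⨁ i, R.V C i) inferInstance

variable {R} {z : G}

/-- If all conjugacy classes in the support of `r` are `{z}`, with `z` central, then the
Yetter-Drinfeld module is homogeneous of degree `z`. -/
theorem proj_eq (hz : z ∈ Subgroup.center G) (hu : ∀ C, R.r C ≠ 0 → R.u C = z) [DecidableEq G]
    (t : G) : R.proj t = if t = z then LinearMap.id else 0 := by
  classical
  refine DirectSum.linearMap_ext _ fun p => IndV.hom_ext _ _ fun h => LinearMap.ext fun w => ?_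
  have hp : h⁻¹ * R.u p.1 * h = z := by
    rw [hu p.1 ((R.nonempty_I_iff _).1 ⟨p.2⟩), mul_assoc, ← Subgroup.mem_center_iff.1 hz h,
      inv_mul_cancel_left]
  change R.proj t (DirectSum.lof ℂ _ _ p (IndV.mk _ _ h w)) =
    (if t = z then LinearMap.id else 0 : R.YD →ₗ[ℂ] R.YD) (DirectSum.lof ℂ _ _ p (IndV.mk _ _ h w))
  rw [proj, DirectSum.lmap_lof, ydProj_mk, hp]
  by_cases ht : t = z
  · rw [if_pos ht, if_pos ht.symm, LinearMap.id_apply]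
  · rw [if_neg ht, if_neg (Ne.symm ht), map_zero, LinearMap.zero_apply]

/-- If `z` is central and acts by `-1` in all the given representations of its centralizer, then
it acts by `-1` in the Yetter-Drinfeld module. -/
theorem act_eq_neg (hz : z ∈ Subgroup.center G) (hu : ∀ C, R.r C ≠ 0 → R.u C = z)
    (hρ : ∀ C i, R.ρ C i ⟨R.u C, Subgroup.mem_centralizer_singleton_iff.2 rfl⟩ =
      (-1 : ℂ) • LinearMap.id) :
    R.act z = (-1 : ℂ) • LinearMap.id := by
  classical
  refine DirectSum.linearMap_ext _ fun p => IndV.hom_ext _ _ fun h => LinearMap.ext fun w => ?_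
  have hp := hu p.1 ((R.nonempty_I_iff _).1 ⟨p.2⟩)
  have hmk : ydAction (R.u p.1) (R.ρ p.1 p.2) z (IndV.mk _ _ h w) =
      (-1 : ℂ) • IndV.mk _ _ h w := by
    refine (ind_mk _ _ _ _ _).trans ?_
    have h1 : h * z⁻¹ = ((Subgroup.centralizer {R.u p.1}).subtype
        ⟨R.u p.1, Subgroup.mem_centralizer_singleton_iff.2 rfl⟩)⁻¹ * h := by
      rw [Subgroup.subtype_apply, hp]
      exact Subgroup.mem_center_iff.1 (inv_mem hz) h
    rw [h1, ← IndV.mk_map_mul _ _ ⟨R.u p.1, Subgroup.mem_centralizer_singleton_iff.2 rfl⟩,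
      mul_inv_cancel_left, hρ, LinearMap.smul_apply, LinearMap.id_apply, map_smul]
  change R.act z (DirectSum.lof ℂ _ _ p (IndV.mk _ _ h w)) =
    (-1 : ℂ) • (DirectSum.lof ℂ _ _ p (IndV.mk _ _ h w))
  rw [act, DirectSum.lmap_lof, hmk, map_smul]

/-- If `z` is central and acts by `-1`, then the braiding is the negative of the flip. -/
theorem isQuantumSymmetric_of_neg [Finite G] (hz : z ∈ Subgroup.center G)
    (hu : ∀ C, R.r C ≠ 0 → R.u C = z)
    (hρ : ∀ C i, R.ρ C i ⟨R.u C, Subgroup.mem_centralizer_singleton_iff.2 rfl⟩ =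
      (-1 : ℂ) • LinearMap.id) : R.IsQuantumSymmetric := by
  classical
  refine ⟨_, Module.Free.chooseBasis ℂ R.YD, fun _ _ => -1, fun a b => ?_, fun _ _ _ => by norm_num⟩
  rw [braiding, LinearMap.comp_apply, LinearEquiv.coe_coe, TensorProduct.comm_tmul,
    LinearMap.sum_apply, Finset.sum_eq_single z]
  · rw [TensorProduct.map_tmul, proj_eq hz hu, if_pos rfl, act_eq_neg hz hu hρ,
      LinearMap.smul_apply, LinearMap.id_apply, LinearMap.id_apply, TensorProduct.smul_tmul']
  · intro t _ ht
    rw [TensorProduct.map_tmul, proj_eq hz hu, if_neg ht, LinearMap.zero_apply,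
      TensorProduct.tmul_zero]
  · simp

end RSR

/-! ### Characters and center of `A ⋊ S_n` -/

section Sign

theorem C2.eq_one_or_eq_g2 (x : C2) : x = 1 ∨ x = g2 := by
  revert x; decide

theorem chi2_g2 : chi2 g2 = -1 := by
  simp [chi2, show g2 ≠ 1 by decide]

/-- The two characters of `C2` are the powers of `chi2`. -/
theorem exists_eq_chi2_pow (ψ : C2 →* ℂˣ) : ∃ d : Fin 2, ∀ x, ψ x = chi2 x ^ (d : ℕ) := by
  have hsq : ψ g2 = 1 ∨ ψ g2 = -1 := by
    have h : ψ g2 * ψ g2 = 1 := by rw [← map_mul, show g2 * g2 = 1 by decide, map_one]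
    rw [Units.ext_iff, Units.val_mul, Units.val_one] at h
    exact (mul_self_eq_one_iff.1 h).imp (fun h => Units.ext h) fun h => Units.ext (by simpa using h)
  rcases hsq with h | h
  · refine ⟨0, fun x => ?_⟩
    rcases C2.eq_one_or_eq_g2 x with rfl | rfl <;> simp [h]
  · refine ⟨1, fun x => ?_⟩
    rcases C2.eq_one_or_eq_g2 x with rfl | rfl <;> simp [h, chi2_g2]

theorem Equiv.Perm.eq_one_of_mem_center {n : ℕ} (hn : 2 < n) {σ : Equiv.Perm (Fin n)}
    (hσ : σ ∈ Subgroup.center (Equiv.Perm (Fin n))) : σ = 1 := by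
  by_contra hne
  obtain ⟨i, hi⟩ : ∃ i, σ i ≠ i := by
    by_contra! h
    exact hne (Equiv.ext h)
  obtain ⟨k, hk⟩ : ∃ k, k ∉ ({i, σ i} : Finset (Fin n)) := by
    by_contra! h
    have := Finset.card_le_card (fun x _ => h x : Finset.univ ⊆ ({i, σ i} : Finset (Fin n)))
    rw [Finset.card_univ, Fintype.card_fin] at this
    exact absurd (this.trans Finset.card_le_two) (by omega)
  simp only [Finset.mem_insert, Finset.mem_singleton, not_or] at hk
  have := DFunLike.congr_fun (Subgroup.mem_center_iff.1 hσ (Equiv.swap i k)) i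
  rw [Equiv.Perm.mul_apply, Equiv.Perm.mul_apply, Equiv.swap_apply_left,
    Equiv.swap_apply_of_ne_of_ne hi (Ne.symm hk.2)] at this
  exact hk.1 (σ.injective this.symm)

namespace SignGroup

variable {n : ℕ} (A : SignGroup n)

/-- Every character of `A` extends to `C2 ^ n` and is hence the restriction of a product of powers
of `chi2`. -/
theorem signChar_surjective : Function.Surjective A.signChar := by
  intro χ
  obtain ⟨ψ, rfl⟩ := MonoidHom.domRestrict_surjective ℂ A.toSubgroup χ
  choose δ hδ using fun j => exists_eq_chi2_pow (ψ.comp (MonoidHom.mulSingle (fun _ => C2) j))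
  refine ⟨δ, MonoidHom.ext fun a => ?_⟩
  change ∏ j, chi2 (a.1 j) ^ (δ j : ℕ) = ψ a.1
  rw [← Finset.univ_prod_mulSingle a.1, map_prod]
  exact Finset.prod_congr rfl fun j _ => by simpa using (hδ j (a.1 j)).symm

theorem signChar_g2 (δ : Fin n → Fin 2) (ha : (fun _ => g2 : Fin n → C2) ∈ A.toSubgroup) :
    A.signChar δ ⟨_, ha⟩ = (-1) ^ ∑ j, (δ j : ℕ) := by
  change ∏ j, chi2 g2 ^ (δ j : ℕ) = _
  rw [Finset.prod_pow_eq_pow_sum, chi2_g2]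

/-- For `n > 2` the only candidate for a nontrivial central element of `A ⋊ S_n` is
`(g2, …, g2)`: the symmetric group has trivial center, and a central element of `A` is constant. -/
theorem eq_of_mem_center (hn : 2 < n) {g : A.Weyl} (hg : g ∈ Subgroup.center A.Weyl) (h1 : g ≠ 1) :
    ∃ ha : (fun _ => g2 : Fin n → C2) ∈ A.toSubgroup, g = SemidirectProduct.inl ⟨_, ha⟩ := by
  rw [Subgroup.mem_center_iff] at hg
  have hr : g.right = 1 := by
    refine Equiv.Perm.eq_one_of_mem_center hn (Subgroup.mem_center_iff.2 fun h => ?_)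
    have := congrArg SemidirectProduct.right (hg (SemidirectProduct.inr h))
    simpa using this
  have hc : ∀ i j, g.left.1 i = g.left.1 j := fun i j => by
    have := congrArg SemidirectProduct.left (hg (SemidirectProduct.inr (Equiv.swap i j)))
    simp only [SemidirectProduct.mul_left, SemidirectProduct.left_inr, SemidirectProduct.right_inr,
      map_one, mul_one, one_mul] at this
    have h2 : g.left.1 ((Equiv.swap i j)⁻¹ i) = g.left.1 i := congrFun (congrArg Subtype.val this) i
    rw [← h2, Equiv.swap_inv, Equiv.swap_apply_left]
  have hconst : g.left.1 = fun _ => g2 := by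
    funext i
    refine (C2.eq_one_or_eq_g2 _).resolve_left fun hi => h1 ?_
    refine SemidirectProduct.ext (Subtype.ext (funext fun j => ?_)) hr
    rw [hc j i, hi]
    rfl
  exact ⟨hconst ▸ g.left.2, SemidirectProduct.ext (Subtype.ext hconst) hr⟩

theorem g2_mem_center (ha : (fun _ => g2 : Fin n → C2) ∈ A.toSubgroup) :
    (SemidirectProduct.inl ⟨_, ha⟩ : A.Weyl) ∈ Subgroup.center A.Weyl := by
  refine Subgroup.mem_center_iff.2 fun g => SemidirectProduct.ext ?_ (by simp)
  have : A.permAction g.right ⟨_, ha⟩ = ⟨_, ha⟩ := rfl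
  simp [this, mul_comm]

end SignGroup

end Sign

theorem ConjClasses.carrier_eq_singleton {G : Type*} [Group G] {C : ConjClasses G} {z : G}
    (hz : z ∈ Subgroup.center G) (hC : z ∈ C.carrier) : C.carrier = {z} := by
  refine Set.eq_singleton_iff_unique_mem.2 ⟨hC, fun y hy => ?_⟩
  rw [ConjClasses.mem_carrier_iff_mk_eq] at hC hy
  obtain ⟨c, hc⟩ := isConj_iff.1 (ConjClasses.mk_eq_mk_iff_isConj.1 (hC.trans hy.symm))
  rw [← hc, Subgroup.mem_center_iff.1 hz, mul_inv_cancel_right]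

/-! ### Central quantum linear spaces -/

theorem theorem3 {n : ℕ} (hn : 2 < n) (A : SignGroup n) (R : RSR.{0, v} A.Weyl)
    (hR : ∃ C, R.r C ≠ 0) :
    R.IsCentralQuantumLinear ↔
      ∃ (ha : (fun _ => g2 : Fin n → C2) ∈ A.toSubgroup) (C : ConjClasses A.Weyl),
        C.carrier = {(SemidirectProduct.inl ⟨fun _ => g2, ha⟩ : A.Weyl)} ∧
        (∀ C', C' ≠ C → R.r C' = 0) ∧
        ∀ i : R.I C, ∃ (δ : Fin n → Fin 2) (W : Type v) (_ : AddCommGroup W) (_ : Module ℂ W)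
          (μ : Representation ℂ (charStabilizer A.permAction (A.signChar δ)) W),
          Odd (∑ j, (δ j : ℕ)) ∧ μ.IsIrreducible ∧
            (theta (R.u C) (A.signChar δ) μ).IsIrreducible ∧
            Nonempty ((R.ρ C i).Equiv (theta (R.u C) (A.signChar δ) μ)) := by
  constructor
  · intro h
    have hcen : ∀ C, R.r C ≠ 0 → R.u C ∈ Subgroup.center A.Weyl := fun C hC =>
      h.central C hC (R.u_mem C)
    have hne : ∀ C, R.r C ≠ 0 → R.u C ≠ 1 := by
      intro C hC h1
      obtain ⟨i⟩ := (R.nonempty_I_iff C).2 hC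
      obtain ⟨q, hq, hq1, -⟩ := h.nonEssentiallyInfinite C hC i
      have := (R.irreducible C i).nontrivial
      obtain ⟨v, hv⟩ := exists_ne (0 : R.V C i)
      have h1' : (⟨R.u C, Subgroup.mem_centralizer_singleton_iff.2 rfl⟩ :
        Subgroup.centralizer {R.u C}) = 1 := Subtype.ext h1
      rw [h1', map_one] at hq
      have hqv : v = q • v := LinearMap.congr_fun hq v
      exact hq1 (smul_left_injective ℂ hv (hqv.symm.trans (one_smul ℂ v).symm))
    obtain ⟨C, hC⟩ := hR
    obtain ⟨ha, hz⟩ := A.eq_of_mem_center hn (hcen C hC) (hne C hC)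
    refine ⟨ha, C, ?_, fun C' hC' => ?_, fun i => ?_⟩
    · rw [← hz]
      exact ConjClasses.carrier_eq_singleton (hcen C hC) (R.u_mem C)
    · by_contra h0
      obtain ⟨_, hz'⟩ := A.eq_of_mem_center hn (hcen C' h0) (hne C' h0)
      have h1 := ConjClasses.mem_carrier_iff_mk_eq.1 (R.u_mem C)
      have h2 := ConjClasses.mem_carrier_iff_mk_eq.1 (R.u_mem C')
      exact hC' (by rw [← h1, ← h2, hz, hz'])
    · have hirr := R.irreducible C i
      have := hirr.nontrivial
      have := Fintype.ofFinite A.toSubgroup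
      obtain ⟨χ, hχ⟩ := Representation.exists_weightSpace_ne_bot
        (((R.ρ C i).comp (toCentralizer (hcen C hC))).comp SemidirectProduct.inl)
      obtain ⟨δ, rfl⟩ := A.signChar_surjective χ
      obtain ⟨hμ, ⟨e⟩⟩ := weightRep_isIrreducible_and_equiv_theta (hcen C hC) hirr hχ
      refine ⟨δ, _, _, _, _, ?_, hμ, hirr.of_equiv e, ⟨e⟩⟩
      -- compare the two descriptions of the action of the central element on a weight vector
      obtain ⟨w, hw, hw0⟩ := Submodule.exists_mem_ne_zero_of_ne_bot hχ
      obtain ⟨q, hq, hq1, -⟩ := h.nonEssentiallyInfinite C hC i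
      by_contra hodd
      have h1 : R.ρ C i (toCentralizer (hcen C hC) (SemidirectProduct.inl ⟨_, ha⟩)) w =
          (A.signChar δ ⟨_, ha⟩ : ℂ) • w := hw ⟨_, ha⟩
      rw [← hz, A.signChar_g2, (Nat.not_odd_iff_even.1 hodd).neg_one_pow] at h1
      have hqw : q • w = ((1 : ℂˣ) : ℂ) • w := (LinearMap.congr_fun hq w).symm.trans h1
      exact hq1 (smul_left_injective ℂ hw0 hqw)
  · rintro ⟨ha, C, hC, h0, hθ⟩
    have hz := A.g2_mem_center ha
    have huC : R.u C = SemidirectProduct.inl ⟨_, ha⟩ := by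
      have := R.u_mem C
      rwa [hC] at this
    have hsupp : ∀ C', R.r C' ≠ 0 → C' = C := fun C' h => by
      by_contra hne
      exact h (h0 C' hne)
    have hu : ∀ C', R.r C' ≠ 0 → R.u C' = SemidirectProduct.inl ⟨_, ha⟩ := fun C' h => by
      rw [hsupp C' h, huC]
    have hρ : ∀ C' i, R.ρ C' i ⟨R.u C', Subgroup.mem_centralizer_singleton_iff.2 rfl⟩ =
        (-1 : ℂ) • LinearMap.id := by
      intro C' i
      obtain rfl := hsupp C' ((R.nonempty_I_iff C').1 ⟨i⟩)
      obtain ⟨δ, W, _, _, μ, hodd, -, -, ⟨e⟩⟩ := hθ i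
      have hval : ((A.signChar δ ⟨_, ha⟩ : ℂˣ) : ℂ) = -1 := by
        rw [A.signChar_g2, hodd.neg_one_pow, Units.val_neg, Units.val_one]
      have hθz := theta_apply_of_mem_center huC (huC ▸ hz) (A.signChar δ) μ
        (Subgroup.mem_centralizer_singleton_iff.2 rfl) hval
      exact e.apply_eq_smul_id hθz
    refine ⟨RSR.isQuantumSymmetric_of_neg hz hu hρ, fun C' _ i => ⟨-1, hρ C' i, by norm_num, ?_⟩,
      fun C' h => ?_⟩
    · exact isOfFinOrder_iff_pow_eq_one.2 ⟨2, by norm_num, by norm_num⟩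
    · rw [hsupp C' h, hC, Set.singleton_subset_iff]
      exact hz
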